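/- Let $d\ge 2$ and let $F\subset\mathbb{R}^{d-1}$ be a compact convex set with $\mathrm{Vol}_{d-1}(F)=1$. Let $\mathrm{CCSF}(F)$ be the set of compact convex sets $K\subset\mathbb{R}^{d}=\mathbb{R}^{d-1}\times\mathbb{R}$ with $\mathrm{Vol}_d(K)=1$ and with floor $F$, that is, $K\subset\{x_d\ge 0\}$ and $K\cap\{x_d=0\}=F\times\{0\}$. For $K\in\mathrm{CCSF}(F)$ let $Q_K(2)$ be the probability that two independent points $U_1,U_2$, uniformly distributed in $K$, both lie on the boundary of the convex hull of $(F\times\{0\})\cup\{U_1,U_2\}$. A unit mountain is a set of volume $1$ of the form $\mathrm{conv}(\{z\}\cup (F\times\{0\}))$ with $z\in\mathbb{R}^d$, $z_d\ge 0$. Unit mountains exist, belong to $\mathrm{CCSF}(F)$, and all have the same value of $Q(2)$, denoted $Q_{\mathrm{UnitMountain}}(2)$. Then: 1. for every $K\in\mathrm{CCSF}(F)$, $\; Q_{\mathrm{UnitMountain}}(2)\le Q_K(2)<1$; 2. for every $\alpha>0$ there is $K\in\mathrm{CCSF}(F)$ with $Q_K(2)\ge 1-\alpha$, and $K$ can be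 chosen to be a trapezoid $\mathrm{conv}\big((F\times\{0\})\cup(cF\times\{h\})\big)$ with $c,h>0$; 3. there is no $K\in\mathrm{CCSF}(F)$ with $Q_K(2)=1$. -/

import Mathlib

open MeasureTheory Set

noncomputable section

/-- `ℝ^d`, written as `ℝ^(d-1) × ℝ`; the second component is the last coordinate `x_d` (the height).
Its `volume` is `d`-dimensional Lebesgue measure. -/
abbrev Space (d : ℕ) : Type := (Fin (d - 1) → ℝ) × ℝ

/-- The copy `F × {0}` of `F ⊆ ℝ^(d-1)` in the hyperplane `x_d = 0`. -/
def baseCopy {d : ℕ} (F : Set (Fin (d - 1) → ℝ)) : Set (Space d) :=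
  F ×ˢ ({0} : Set ℝ)

/-- `F` is the floor of `K`: `K` lies in the half space `x_d ≥ 0` and meets the hyperplane
`x_d = 0` exactly in `F × {0}`. -/
def IsFloor {d : ℕ} (F : Set (Fin (d - 1) → ℝ)) (K : Set (Space d)) : Prop :=
  (∀ x ∈ K, 0 ≤ x.2) ∧ K ∩ {x | x.2 = 0} = baseCopy F

/-- `CCSF(F)`: the compact convex sets of `ℝ^d` with floor `F` and volume `1`. -/
def CCSF {d : ℕ} (F : Set (Fin (d - 1) → ℝ)) : Set (Set (Space d)) :=
  {K | IsCompact K ∧ Convex ℝ K ∧ IsFloor F K ∧ volume K = 1}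

/-- The mountain with base `F` and apex `z`. -/
def Mountain {d : ℕ} (F : Set (Fin (d - 1) → ℝ)) (z : Space d) : Set (Space d) :=
  convexHull ℝ ({z} ∪ baseCopy F)

/-- The unit mountains: the mountains over `F` (with apex at height `≥ 0`) of volume `1`. -/
def UnitMountains {d : ℕ} (F : Set (Fin (d - 1) → ℝ)) : Set (Set (Space d)) :=
  {M | (∃ z : Space d, 0 ≤ z.2 ∧ M = Mountain F z) ∧ volume M = 1}

/-- The trapezoid with bases `F × {0}` and `(c F) × {h}`. -/
def Trapezoid {d : ℕ} (F : Set (Fin (d - 1) → ℝ)) (c h : ℝ) : Set (Space d) :=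
  convexHull ℝ (baseCopy F ∪ ((fun x => c • x) '' F) ×ˢ ({h} : Set ℝ))

/-- The uniform probability distribution on `K` (for `0 < volume K < ∞`). -/
def unif {d : ℕ} (K : Set (Space d)) : Measure (Space d) :=
  ProbabilityTheory.cond volume K

/-- `Q_K(2)`, for `K` with floor `F`: the probability that two independent uniform points of `K`
both lie on the boundary of the convex hull of these two points and the floor. -/
def Q {d : ℕ} (F : Set (Fin (d - 1) → ℝ)) (K : Set (Space d)) : ℝ :=
  ((unif K).prod (unif K)).real
    {p | p.1 ∈ frontier (convexHull ℝ (baseCopy F ∪ {p.1, p.2})) ∧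
         p.2 ∈ frontier (convexHull ℝ (baseCopy F ∪ {p.1, p.2}))}

end

/-!
Of two points of `K`, at most one is in the interior of the hull of the floor and both points, and
this happens, up to null sets, exactly when the point lies in the mountain over the other one. That
mountain lies in `K` and has volume `z.2 / d` if its apex is `z`. Averaging over the apex gives
`Q F K = 1 - (2 / d) * ∫ x in K, x.2` (`Q_eq`), so everything is about the mean height of `K`.

* The mean height is positive, hence `Q F K < 1`.
* A trapezoid of volume one with a wide roof is flat, so its mean height is arbitrarily small
  (`exists_trapezoid`).
* A unit mountain has the largest mean height (`integral_height_le`). By the Brunn–Minkowski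
  inequality (`brunnMinkowski`), the `(d - 1)`-th root of the slice volume of `K` lies above each of
  its chords from the floor, while for a mountain it is affine, with the same value `1` at the
  floor. So the two slice volumes cross only once (`slice_domination_antitone`), and since the total
  volumes agree, the mountain has more of its mass at large heights. As unit mountains themselves
  belong to `CCSF F`, their values of `Q` coincide.

The Brunn–Minkowski inequality is obtained from the Prékopa–Leindler inequality, which is proved by
induction on the dimension.
-/

open scoped ENNReal Pointwise

/-! ### Brunn–Minkowski on the line -/

/-- The translates `A + min B` and `max A + B` both lie in `C` and share only the point
`max A + min B`. -/
theorem volume_add_le_of_isCompact {A B C : Set ℝ} (hA : IsCompact A) (hB : IsCompact B)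
    (hA0 : A.Nonempty) (hB0 : B.Nonempty) (h : ∀ x ∈ A, ∀ y ∈ B, x + y ∈ C) :
    volume A + volume B ≤ volume C := by
  have hA' := hA.sSup_mem hA0
  have hB' := hB.sInf_mem hB0
  set a := sSup A
  set b := sInf B
  have h1 : volume ((fun x => x + b) '' A) = volume A := by
    simp [Set.image_add_right, measure_preimage_add_right]
  have h2 : volume ((fun x => a + x) '' B) = volume B := by
    simp [Set.image_add_left, measure_preimage_add]
  have hdis : AEDisjoint volume ((fun x => x + b) '' A) ((fun x => a + x) '' B) := by
    refine measure_mono_null (t := {a + b}) ?_ (by simp)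
    rintro _ ⟨⟨x, hx, rfl⟩, ⟨y, hy, hxy⟩⟩
    have := le_csSup hA.bddAbove hx
    have := csInf_le hB.bddBelow hy
    simp only [mem_singleton_iff] at *
    linarith
  rw [← h1, ← h2, ← measure_union₀ _ hdis]
  · apply measure_mono
    rintro _ (⟨x, hx, rfl⟩ | ⟨x, hx, rfl⟩)
    · exact h x hx b hB'
    · exact h a hA' x hx
  · exact (hB.image (by fun_prop)).measurableSet.nullMeasurableSet

theorem volume_add_le_of_measurableSet {A B C : Set ℝ} (hA : MeasurableSet A)
    (hB : MeasurableSet B) (hA0 : A.Nonempty) (hB0 : B.Nonempty)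
    (h : ∀ x ∈ A, ∀ y ∈ B, x + y ∈ C) :
    volume A + volume B ≤ volume C := by
  obtain ⟨a, ha⟩ := hA0
  obtain ⟨b, hb⟩ := hB0
  have key : ∀ A' ⊆ A, IsCompact A' → ∀ B' ⊆ B, IsCompact B' →
      volume A' + volume B' ≤ volume C := by
    intro A' hA' hcA B' hB' hcB
    refine le_trans (add_le_add (measure_mono (subset_insert a A'))
      (measure_mono (subset_insert b B'))) ?_
    refine volume_add_le_of_isCompact (hcA.insert a) (hcB.insert b) (by simp) (by simp) ?_
    intro x hx y hy
    exact h x (insert_subset ha hA' hx) y (insert_subset hb hB' hy)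
  rw [hA.measure_eq_iSup_isCompact, hB.measure_eq_iSup_isCompact]
  simp only [iSup_and', iSup_subtype']
  have : Nonempty {i : Set ℝ // i ⊆ A ∧ IsCompact i} := ⟨⟨∅, by simp⟩⟩
  have : Nonempty {i : Set ℝ // i ⊆ B ∧ IsCompact i} := ⟨⟨∅, by simp⟩⟩
  exact ENNReal.iSup_add_iSup_le fun i j => key i.1 i.2.1 i.2.2 j.1 j.2.1 j.2.2

theorem volume_combo_le {A B C : Set ℝ} {p q : ℝ} (hp : 0 < p) (hq : 0 < q)
    (hA : MeasurableSet A) (hB : MeasurableSet B) (hA0 : A.Nonempty) (hB0 : B.Nonempty)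
    (h : ∀ x ∈ A, ∀ y ∈ B, p * x + q * y ∈ C) :
    ENNReal.ofReal p * volume A + ENNReal.ofReal q * volume B ≤ volume C := by
  have h1 : ∀ {r : ℝ} (s : Set ℝ), 0 < r → volume (r • s) = ENNReal.ofReal r * volume s := by
    intro r s hr
    rw [Measure.addHaar_smul_of_nonneg _ hr.le]; simp
  rw [← h1 A hp, ← h1 B hq]
  refine volume_add_le_of_measurableSet (hA.const_smul₀ p) (hB.const_smul₀ q)
    (hA0.smul_set) (hB0.smul_set) ?_
  rintro _ ⟨x, hx, rfl⟩ _ ⟨y, hy, rfl⟩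
  exact h x hx y hy

/-! ### The Prékopa–Leindler inequality -/

theorem lintegral_eq_lintegral_Ioi_meas_lt {α : Type*} [MeasurableSpace α] (μ : Measure α)
    {f : α → ℝ≥0∞} (hf : Measurable f) (hfin : ∀ x, f x ≠ ∞) :
    ∫⁻ x, f x ∂μ = ∫⁻ t in Ioi (0 : ℝ), μ {x | ENNReal.ofReal t < f x} := by
  have := lintegral_eq_lintegral_meas_lt μ (f := fun x => (f x).toReal)
    (Filter.Eventually.of_forall fun x => ENNReal.toReal_nonneg) hf.ennreal_toReal.aemeasurable
  simp only [ENNReal.ofReal_toReal (hfin _)] at this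
  rw [this]
  refine setLIntegral_congr_fun measurableSet_Ioi fun t ht => ?_
  congr 1; ext x
  exact (ENNReal.ofReal_lt_iff_lt_toReal (le_of_lt ht) (hfin x)).symm

/-- When both suprema are `1`, the superlevel sets of `f` and `g` at a height `t < 1` are nonempty,
so the one-dimensional Brunn–Minkowski inequality applies to each of them. This gives the
arithmetic mean of the integrals, which is stronger than the geometric one. -/
theorem lintegral_combo_le_of_iSup_eq_one {p q : ℝ} (hp : 0 < p) (hq : 0 < q) (hpq : p + q = 1)
    {f g h : ℝ → ℝ≥0∞} (hf : Measurable f) (hg : Measurable g) (hh : Measurable h)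
    (hf1 : ⨆ x, f x = 1) (hg1 : ⨆ x, g x = 1)
    (H : ∀ x y, f x ^ p * g y ^ q ≤ h (p * x + q * y)) :
    ENNReal.ofReal p * (∫⁻ x, f x) + ENNReal.ofReal q * (∫⁻ x, g x) ≤ ∫⁻ x, h x := by
  have hfle : ∀ x, f x ≤ 1 := fun x => hf1 ▸ le_iSup f x
  have hgle : ∀ x, g x ≤ 1 := fun x => hg1 ▸ le_iSup g x
  -- capping `h` at `1` keeps the hypothesis, since `f, g ≤ 1`, and makes the layer cake formula apply
  have hm : Measurable fun x => min (h x) 1 := hh.min measurable_const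
  refine le_trans ?_ (lintegral_mono fun x => min_le_left (h x) 1)
  rw [lintegral_eq_lintegral_Ioi_meas_lt _ hf fun x => ((hfle x).trans_lt ENNReal.one_lt_top).ne,
    lintegral_eq_lintegral_Ioi_meas_lt _ hg fun x => ((hgle x).trans_lt ENNReal.one_lt_top).ne,
    lintegral_eq_lintegral_Ioi_meas_lt _ hm
      fun x => ((min_le_right _ _).trans_lt ENNReal.one_lt_top).ne]
  have hanti : ∀ u : ℝ → ℝ≥0∞, Measurable fun t : ℝ => volume {x | ENNReal.ofReal t < u x} := by
    intro u
    refine Antitone.measurable fun s t hst => measure_mono fun x hx => ?_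
    exact lt_of_le_of_lt (ENNReal.ofReal_le_ofReal hst) hx
  rw [← lintegral_const_mul _ (hanti f), ← lintegral_const_mul _ (hanti g),
    ← lintegral_add_left ((hanti f).const_mul _)]
  refine setLIntegral_mono (hanti _) fun t ht => ?_
  have ht0 : (0 : ℝ) < t := ht
  rcases lt_or_ge t 1 with ht1 | ht1
  · have ht1' : ENNReal.ofReal t < 1 := by
      rwa [← ENNReal.ofReal_one, ENNReal.ofReal_lt_ofReal_iff one_pos]
    refine volume_combo_le hp hq (measurableSet_lt measurable_const hf)
      (measurableSet_lt measurable_const hg) ?_ ?_ ?_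
    · exact lt_iSup_iff.1 (hf1 ▸ ht1')
    · exact lt_iSup_iff.1 (hg1 ▸ ht1')
    · intro x hx y hy
      refine lt_min (lt_of_lt_of_le ?_ (H x y)) ht1'
      calc ENNReal.ofReal t = ENNReal.ofReal t ^ p * ENNReal.ofReal t ^ q := by
            rw [← ENNReal.rpow_add _ _ (by simpa using ht0) (by simp), hpq, ENNReal.rpow_one]
        _ < _ := ENNReal.mul_lt_mul (ENNReal.rpow_lt_rpow hx hp) (ENNReal.rpow_lt_rpow hy hq)
  · have h1 : (1 : ℝ≥0∞) ≤ ENNReal.ofReal t := by simpa using ht1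
    have e1 : {x | ENNReal.ofReal t < f x} = ∅ := by
      ext x; simpa using (hfle x).trans h1
    have e2 : {x | ENNReal.ofReal t < g x} = ∅ := by
      ext x; simpa using (hgle x).trans h1
    simp [e1, e2]

theorem ENNReal.geom_mean_le_arith_mean2 {p q : ℝ} (hp : 0 < p) (hq : 0 < q) (hpq : p + q = 1)
    (a b : ℝ≥0∞) : a ^ p * b ^ q ≤ ENNReal.ofReal p * a + ENNReal.ofReal q * b := by
  have hp' : (0:ℝ≥0∞) < ENNReal.ofReal p := by simpa using hp
  have hq' : (0:ℝ≥0∞) < ENNReal.ofReal q := by simpa using hq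
  rcases eq_or_ne a ∞ with rfl | ha
  · rw [ENNReal.mul_top hp'.ne']; simp
  rcases eq_or_ne b ∞ with rfl | hb
  · rw [ENNReal.mul_top hq'.ne']; simp
  lift a to NNReal using ha
  lift b to NNReal using hb
  have := NNReal.geom_mean_le_arith_mean2_weighted ⟨p, hp.le⟩ ⟨q, hq.le⟩ a b
    (by ext; exact hpq)
  rw [ENNReal.ofReal_eq_coe_nnreal hp.le, ENNReal.ofReal_eq_coe_nnreal hq.le,
    ← ENNReal.coe_rpow_of_nonneg _ hp.le, ← ENNReal.coe_rpow_of_nonneg _ hq.le]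
  exact_mod_cast this

/-- The Prékopa–Leindler inequality on the line for bounded functions, by normalizing the suprema. -/
theorem prekopaLeindler_real_of_iSup_ne_top {p q : ℝ} (hp : 0 < p) (hq : 0 < q) (hpq : p + q = 1)
    {f g h : ℝ → ℝ≥0∞} (hf : Measurable f) (hg : Measurable g) (hh : Measurable h)
    (hf1 : ⨆ x, f x ≠ ∞) (hg1 : ⨆ x, g x ≠ ∞)
    (H : ∀ x y, f x ^ p * g y ^ q ≤ h (p * x + q * y)) :
    (∫⁻ x, f x) ^ p * (∫⁻ x, g x) ^ q ≤ ∫⁻ x, h x := by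
  rcases eq_or_ne (⨆ x, f x) 0 with hf0 | hf0
  · have : ∀ x, f x = 0 := by simpa using hf0
    simp [this, hp]
  rcases eq_or_ne (⨆ x, g x) 0 with hg0 | hg0
  · have : ∀ x, g x = 0 := by simpa using hg0
    simp [this, hq]
  set a := ⨆ x, f x
  set b := ⨆ x, g x
  have hc0 : a ^ p * b ^ q ≠ 0 := by
    simp [hf0, hg0, hp, hq, hf1, hg1, not_lt.2 hp.le, not_lt.2 hq.le]
  have hct : a ^ p * b ^ q ≠ ∞ :=
    ENNReal.mul_ne_top (ENNReal.rpow_ne_top_of_nonneg hp.le hf1)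
      (ENNReal.rpow_ne_top_of_nonneg hq.le hg1)
  have key := lintegral_combo_le_of_iSup_eq_one hp hq hpq (f := fun x => a⁻¹ * f x)
    (g := fun x => b⁻¹ * g x) (h := fun x => (a ^ p * b ^ q)⁻¹ * h x)
    (hf.const_mul _) (hg.const_mul _) (hh.const_mul _)
    (by rw [← ENNReal.mul_iSup]; exact ENNReal.inv_mul_cancel hf0 hf1)
    (by rw [← ENNReal.mul_iSup]; exact ENNReal.inv_mul_cancel hg0 hg1)
    (by
      intro x y
      rw [ENNReal.mul_rpow_of_nonneg _ _ hp.le, ENNReal.mul_rpow_of_nonneg _ _ hq.le,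
        ENNReal.inv_rpow, ENNReal.inv_rpow, mul_mul_mul_comm,
        ← ENNReal.mul_inv (.inr (ENNReal.rpow_ne_top_of_nonneg hq.le hg1))
          (.inl (ENNReal.rpow_ne_top_of_nonneg hp.le hf1))]
      gcongr
      exact H x y)
  rw [lintegral_const_mul _ hf, lintegral_const_mul _ hg, lintegral_const_mul _ hh] at key
  have key2 := (ENNReal.geom_mean_le_arith_mean2 hp hq hpq _ _).trans key
  rw [ENNReal.mul_rpow_of_nonneg _ _ hp.le, ENNReal.mul_rpow_of_nonneg _ _ hq.le,
        ENNReal.inv_rpow, ENNReal.inv_rpow, mul_mul_mul_comm,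
        ← ENNReal.mul_inv (.inr (ENNReal.rpow_ne_top_of_nonneg hq.le hg1))
          (.inl (ENNReal.rpow_ne_top_of_nonneg hp.le hf1))] at key2
  exact (ENNReal.mul_le_mul_iff_right (ENNReal.inv_ne_zero.2 hct) (ENNReal.inv_ne_top.2 hc0)).1 key2

theorem prekopaLeindler_real {p q : ℝ} (hp : 0 < p) (hq : 0 < q) (hpq : p + q = 1)
    {f g h : ℝ → ℝ≥0∞} (hf : Measurable f) (hg : Measurable g) (hh : Measurable h)
    (H : ∀ x y, f x ^ p * g y ^ q ≤ h (p * x + q * y)) :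
    (∫⁻ x, f x) ^ p * (∫⁻ x, g x) ^ q ≤ ∫⁻ x, h x := by
  -- apply the bounded case to truncations at height `N`, and let `N` tend to infinity
  have trunc : ∀ (u : ℝ → ℝ≥0∞), Measurable u →
      Filter.Tendsto (fun N : ℕ => ∫⁻ x, min (u x) N) Filter.atTop (nhds (∫⁻ x, u x)) := by
    intro u hu
    refine lintegral_tendsto_of_tendsto_of_monotone
      (fun N => (hu.min measurable_const).aemeasurable) ?_ ?_
    · refine Filter.Eventually.of_forall fun x m n hmn => ?_
      exact min_le_min_left _ (by exact_mod_cast hmn)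
    · refine Filter.Eventually.of_forall fun x => ?_
      have := (tendsto_const_nhds (x := u x)).min ENNReal.tendsto_nat_nhds_top
      simpa using this
  have step : ∀ N : ℕ, (∫⁻ x, min (f x) N) ^ p * (∫⁻ x, min (g x) N) ^ q ≤ ∫⁻ x, h x := by
    intro N
    have bd : ∀ u : ℝ → ℝ≥0∞, ⨆ x, min (u x) (N : ℝ≥0∞) ≠ ∞ := fun u =>
      ne_top_of_le_ne_top (ENNReal.natCast_ne_top N) (iSup_le fun x => min_le_right _ _)
    refine prekopaLeindler_real_of_iSup_ne_top hp hq hpq (hf.min measurable_const)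
      (hg.min measurable_const) hh (bd f) (bd g) fun x y => le_trans ?_ (H x y)
    gcongr <;> exact min_le_left _ _
  have cont : ∀ u : ℝ → ℝ≥0∞, Measurable u → ∀ r : ℝ, Filter.Tendsto
      (fun N : ℕ => (∫⁻ x, min (u x) N) ^ r) Filter.atTop (nhds ((∫⁻ x, u x) ^ r)) :=
    fun u hu r => (ENNReal.continuous_rpow_const.tendsto _).comp (trunc u hu)
  by_cases h0 : (∫⁻ x, f x) = 0 ∨ (∫⁻ x, g x) = 0
  · rcases h0 with h0 | h0 <;> simp [h0, hp, hq]
  push Not at h0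
  -- nonzero factors rule out the discontinuity of `ℝ≥0∞` multiplication at `0 * ∞`
  refine le_of_tendsto (ENNReal.Tendsto.mul (cont f hf p) ?_ (cont g hg q) ?_)
    (Filter.Eventually.of_forall step)
  · left; simp [h0.1, hp.le]
  · left; simp [h0.2, hq.le]

/-- The Prékopa–Leindler inequality in `ℝⁿ`. Fixing the first coordinate, the inductive hypothesis
says that the marginals satisfy the hypothesis of the one-dimensional inequality. -/
theorem prekopaLeindler {p q : ℝ} (hp : 0 < p) (hq : 0 < q) (hpq : p + q = 1) :
    ∀ (n : ℕ) {f g h : (Fin n → ℝ) → ℝ≥0∞}, Measurable f → Measurable g → Measurable h →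
    (∀ x y, f x ^ p * g y ^ q ≤ h (p • x + q • y)) →
    (∫⁻ x, f x) ^ p * (∫⁻ x, g x) ^ q ≤ ∫⁻ x, h x := by
  intro n
  induction n with
  | zero =>
    intro f g h hf hg hh H
    have e : ∀ u : (Fin 0 → ℝ) → ℝ≥0∞, ∫⁻ x, u x = u 0 := by
      intro u
      rw [lintegral_unique]
      rw [volume_pi, Measure.pi_of_empty _ 0, measure_univ, mul_one]
      exact congrArg u (Subsingleton.elim _ _)
    simpa [e] using H 0 0
  | succ n ih =>
    intro f g h hf hg hh H
    let e := MeasurableEquiv.piFinSuccAbove (fun _ : Fin (n + 1) => ℝ) 0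
    have he : MeasurePreserving e volume volume :=
      volume_preserving_piFinSuccAbove (fun _ : Fin (n + 1) => ℝ) 0
    have fub : ∀ u : (Fin (n + 1) → ℝ) → ℝ≥0∞, Measurable u →
        ∫⁻ x, u x = ∫⁻ t : ℝ, ∫⁻ y : Fin n → ℝ, u (e.symm (t, y)) := by
      intro u hu
      rw [← (he.symm e).lintegral_comp hu, Measure.volume_eq_prod, lintegral_prod]
      exact (hu.comp e.symm.measurable).aemeasurable
    have hsl : ∀ u : (Fin (n + 1) → ℝ) → ℝ≥0∞, Measurable u →
        Measurable fun t : ℝ => ∫⁻ y : Fin n → ℝ, u (e.symm (t, y)) := by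
      intro u hu
      exact Measurable.lintegral_prod_right' (hu.comp e.symm.measurable)
    rw [fub f hf, fub g hg, fub h hh]
    refine prekopaLeindler_real hp hq hpq (hsl f hf) (hsl g hg) (hsl h hh) fun s t => ?_
    have hm : ∀ (u : (Fin (n + 1) → ℝ) → ℝ≥0∞) (s : ℝ), Measurable u →
        Measurable fun y : Fin n → ℝ => u (e.symm (s, y)) := by
      intro u s hu
      exact hu.comp (e.symm.measurable.comp measurable_prodMk_left)
    refine ih (hm f s hf) (hm g t hg) (hm h _ hh) fun x y => ?_
    refine (H _ _).trans (le_of_eq ?_)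
    congr 1
    ext i
    refine Fin.cases ?_ (fun j => ?_) i <;> simp [e, MeasurableEquiv.piFinSuccAbove]

/-! ### The Brunn–Minkowski inequality -/

/-- The multiplicative Brunn–Minkowski inequality for sets of volume one: Prékopa–Leindler for
indicator functions. -/
theorem one_le_volume_of_combo {n : ℕ} {p q : ℝ} (hp : 0 < p) (hq : 0 < q) (hpq : p + q = 1)
    {A B C : Set (Fin n → ℝ)} (hA : MeasurableSet A) (hB : MeasurableSet B)
    (hC : MeasurableSet C) (hA1 : volume A = 1) (hB1 : volume B = 1)
    (h : ∀ x ∈ A, ∀ y ∈ B, p • x + q • y ∈ C) : 1 ≤ volume C := by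
  have := prekopaLeindler hp hq hpq n (f := A.indicator 1) (g := B.indicator 1)
    (h := C.indicator 1) (measurable_one.indicator hA) (measurable_one.indicator hB)
    (measurable_one.indicator hC) (by
      intro x y
      by_cases hx : x ∈ A
      · by_cases hy : y ∈ B
        · simp [hx, hy, h x hx y hy]
        · simp [hy, hq]
      · simp [hx, hp])
  simpa [lintegral_indicator_one, hA, hB, hC, hA1, hB1] using this

/-- The Brunn–Minkowski inequality `|C|^{1/n} ≥ p |A|^{1/n} + q |B|^{1/n}` for `C ⊇ p A + q B`, with
`|A| = 1` and `|B|^{1/n} = v`. Dividing `C` by `p + q v` and `B` by `v` reduces it to sets of volume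
one and weights of sum one. `C` is a measurable superset because a Minkowski sum of measurable
sets may fail to be measurable. -/
theorem brunnMinkowski {n : ℕ} {p q v : ℝ} (hp : 0 < p) (hq : 0 < q) (hv : 0 < v)
    {A B C : Set (Fin n → ℝ)} (hA : MeasurableSet A) (hB : MeasurableSet B)
    (hC : MeasurableSet C) (hA1 : volume A = 1) (hB1 : volume B = ENNReal.ofReal (v ^ n))
    (h : ∀ x ∈ A, ∀ y ∈ B, p • x + q • y ∈ C) :
    ENNReal.ofReal ((p + q * v) ^ n) ≤ volume C := by
  set L := p + q * v
  have hL : 0 < L := by positivity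
  have sc : ∀ (r : ℝ) (s : Set (Fin n → ℝ)), 0 < r →
      volume (r • s) = ENNReal.ofReal (r ^ n) * volume s := by
    intro r s hr
    rw [Measure.addHaar_smul_of_nonneg _ hr.le]; simp
  have key := one_le_volume_of_combo (p := p / L) (q := q * v / L) (A := A) (B := v⁻¹ • B)
    (C := L⁻¹ • C) (by positivity) (by positivity) (by rw [← add_div]; exact div_self hL.ne')
    hA (hB.const_smul₀ _) (hC.const_smul₀ _) hA1
    (by rw [sc _ _ (by positivity), hB1, ← ENNReal.ofReal_mul (by positivity), ← mul_pow,
          inv_mul_cancel₀ hv.ne']; simp)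
    (by
      rintro x hx _ ⟨y, hy, rfl⟩
      refine ⟨p • x + q • y, h x hx y hy, ?_⟩
      simp only [smul_add, smul_smul]
      congr 2 <;> field_simp)
  rw [sc _ _ (by positivity)] at key
  calc ENNReal.ofReal (L ^ n) = ENNReal.ofReal (L ^ n) * 1 := by simp
    _ ≤ ENNReal.ofReal (L ^ n) * (ENNReal.ofReal (L⁻¹ ^ n) * volume C) := by gcongr
    _ = volume C := by
      rw [← mul_assoc, ← ENNReal.ofReal_mul (by positivity), ← mul_pow, mul_inv_cancel₀ hL.ne']
      simp

/-! ### Slicing -/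

theorem volume_eq_lintegral_slice {d : ℕ} {S : Set (Space d)} (hS : MeasurableSet S) :
    volume S = ∫⁻ t : ℝ, volume {x | ((x, t) : Space d) ∈ S} := by
  rw [Measure.volume_eq_prod, Measure.prod_apply_symm hS]; rfl

theorem measurableSet_slice {d : ℕ} {S : Set (Space d)} (hS : MeasurableSet S) (t : ℝ) :
    MeasurableSet {x | ((x, t) : Space d) ∈ S} :=
  measurable_prodMk_right hS

theorem volume_height_eq {d : ℕ} (t : ℝ) : volume {x : Space d | x.2 = t} = 0 := by
  have : {x : Space d | x.2 = t} = univ ×ˢ {t} := by ext; simp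
  rw [this, Measure.volume_eq_prod, Measure.prod_prod]
  simp

theorem volume_smul_eq {n : ℕ} {r : ℝ} (hr : 0 ≤ r) (s : Set (Fin n → ℝ)) :
    volume (r • s) = ENNReal.ofReal (r ^ n) * volume s := by
  rw [Measure.addHaar_smul_of_nonneg _ hr]; simp

/-- The factor `∫₀¹ ((1 - s) + s c)ⁿ ds`: the volume of a frustum of height one whose floor has
volume one and whose roof is the floor scaled by `c`. -/
noncomputable def frustumFactor (n : ℕ) (c : ℝ) : ℝ := ∫ s in (0 : ℝ)..1, (1 - s + s * c) ^ n

theorem lintegral_Icc_frustum {n : ℕ} {c h : ℝ} (hc : 0 ≤ c) (hh : 0 < h) :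
    ∫⁻ t in Icc 0 h, ENNReal.ofReal ((1 - t / h + t / h * c) ^ n) =
      ENNReal.ofReal (h * frustumFactor n c) := by
  rw [← ofReal_integral_eq_lintegral_ofReal]
  · rw [integral_Icc_eq_integral_Ioc, ← intervalIntegral.integral_of_le hh.le]
    have := intervalIntegral.integral_comp_div (a := 0) (b := h)
      (fun s : ℝ => (1 - s + s * c) ^ n) hh.ne'
    rw [this]
    simp [frustumFactor, hh.ne']
  · exact (Continuous.continuousOn (by fun_prop)).integrableOn_Icc
  · filter_upwards [ae_restrict_mem measurableSet_Icc] with t ht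
    have : t / h ≤ 1 := (div_le_one hh).2 ht.2
    have : 0 ≤ t / h := div_nonneg ht.1 hh.le
    have : 0 ≤ 1 - t / h + t / h * c := by nlinarith [mul_nonneg this hc]
    exact pow_nonneg this n

theorem frustumFactor_zero (n : ℕ) : frustumFactor n 0 = 1 / (n + 1) := by
  have := intervalIntegral.integral_comp_sub_left (a := 0) (b := 1) (fun s : ℝ => s ^ n) 1
  simp [frustumFactor, this]

theorem le_frustumFactor {n : ℕ} (hn : n ≠ 0) {c : ℝ} (hc : 1 ≤ c) :
    (1 + c) / 2 ≤ frustumFactor n c := by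
  have h1 : ∫ s in (0 : ℝ)..1, (1 + s * (c - 1)) = (1 + c) / 2 := by
    rw [intervalIntegral.integral_add (by simp) (Continuous.intervalIntegrable (by fun_prop) _ _),
      intervalIntegral.integral_mul_const]
    simp; ring
  rw [← h1, frustumFactor]
  refine intervalIntegral.integral_mono_on (by simp)
    (Continuous.intervalIntegrable (by fun_prop) _ _)
    (Continuous.intervalIntegrable (by fun_prop) _ _) fun s hs => ?_
  have e : 1 - s + s * c = 1 + s * (c - 1) := by ring
  rw [e]
  exact le_self_pow₀ (by nlinarith [mul_nonneg hs.1 (sub_nonneg.2 hc)]) hn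

/-! ### Hulls of two parallel convex sets -/

section
variable {d : ℕ} {F G : Set (Fin (d - 1) → ℝ)}

theorem convex_baseCopy (hF : Convex ℝ F) : Convex ℝ (baseCopy F) := hF.prod (convex_singleton 0)

theorem mem_convexHull_baseCopy_union (hF : Convex ℝ F) (hG : Convex ℝ G) (hF0 : F.Nonempty)
    (hG0 : G.Nonempty) {h : ℝ} {x : Space d} :
    x ∈ convexHull ℝ (baseCopy F ∪ G ×ˢ {h}) ↔
      ∃ s ∈ Icc (0 : ℝ) 1, ∃ f ∈ F, ∃ g ∈ G, x = ((1 - s) • f + s • g, s * h) := by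
  rw [(convex_baseCopy hF).convexHull_union (hG.prod (convex_singleton h))
    (hF0.prod (singleton_nonempty 0)) (hG0.prod (singleton_nonempty h)), mem_convexJoin]
  constructor
  · rintro ⟨⟨f, a⟩, ⟨hf, ha⟩, ⟨g, b⟩, ⟨hg, hb⟩, hx⟩
    simp only [mem_singleton_iff] at ha hb
    subst ha hb
    rw [segment_eq_image] at hx
    obtain ⟨s, hs, rfl⟩ := hx
    exact ⟨s, hs, f, hf, g, hg, by simp⟩
  · rintro ⟨s, hs, f, hf, g, hg, rfl⟩
    refine ⟨(f, 0), ⟨hf, rfl⟩, (g, h), ⟨hg, rfl⟩, ?_⟩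
    rw [segment_eq_image]
    exact ⟨s, hs, by simp⟩

theorem slice_convexHull_baseCopy_union (hF : Convex ℝ F) (hG : Convex ℝ G) (hF0 : F.Nonempty)
    (hG0 : G.Nonempty) {h : ℝ} (hh : 0 < h) {x : Fin (d - 1) → ℝ} {t : ℝ} :
    ((x, t) : Space d) ∈ convexHull ℝ (baseCopy F ∪ G ×ˢ {h}) ↔
      t ∈ Icc 0 h ∧ x ∈ (1 - t / h) • F + (t / h) • G := by
  rw [mem_convexHull_baseCopy_union hF hG hF0 hG0]
  constructor
  · rintro ⟨s, hs, f, hf, g, hg, e⟩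
    obtain ⟨rfl, rfl⟩ := Prod.mk.inj e
    rw [mul_div_cancel_right₀ _ hh.ne']
    exact ⟨⟨mul_nonneg hs.1 hh.le, mul_le_of_le_one_left hh.le hs.2⟩,
      add_mem_add (smul_mem_smul_set hf) (smul_mem_smul_set hg)⟩
  · rintro ⟨ht, _, ⟨f, hf, rfl⟩, _, ⟨g, hg, rfl⟩, rfl⟩
    exact ⟨t / h, ⟨div_nonneg ht.1 hh.le, (div_le_one hh).2 ht.2⟩, f, hf, g, hg,
      by simp [hh.ne']⟩

theorem isCompact_convexHull_baseCopy_union (hF : Convex ℝ F) (hG : Convex ℝ G)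
    (hF0 : F.Nonempty) (hG0 : G.Nonempty) (hFc : IsCompact F) (hGc : IsCompact G) (h : ℝ) :
    IsCompact (convexHull ℝ (baseCopy F ∪ G ×ˢ ({h} : Set ℝ)) : Set (Space d)) := by
  have : (convexHull ℝ (baseCopy F ∪ G ×ˢ ({h} : Set ℝ)) : Set (Space d)) =
      (fun q : ℝ × (Fin (d - 1) → ℝ) × (Fin (d - 1) → ℝ) =>
        (((1 - q.1) • q.2.1 + q.1 • q.2.2, q.1 * h) : Space d)) '' (Icc 0 1 ×ˢ F ×ˢ G) := by
    ext x
    rw [mem_convexHull_baseCopy_union hF hG hF0 hG0]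
    constructor
    · rintro ⟨s, hs, f, hf, g, hg, rfl⟩
      exact ⟨(s, f, g), ⟨hs, hf, hg⟩, rfl⟩
    · rintro ⟨⟨s, f, g⟩, ⟨hs, hf, hg⟩, rfl⟩
      exact ⟨s, hs, f, hf, g, hg, rfl⟩
  rw [this]
  exact (isCompact_Icc.prod (hFc.prod hGc)).image (by fun_prop)

/-- The hull of the floor and a convex set in a higher horizontal hyperplane has floor `F`. It covers
mountains and trapezoids at once. -/
theorem convexHull_baseCopy_union_mem_CCSF (hF : Convex ℝ F) (hG : Convex ℝ G) (hF0 : F.Nonempty)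
    (hG0 : G.Nonempty) (hFc : IsCompact F) (hGc : IsCompact G) {h : ℝ} (hh : 0 < h)
    (hvol : volume (convexHull ℝ (baseCopy F ∪ G ×ˢ ({h} : Set ℝ)) : Set (Space d)) = 1) :
    convexHull ℝ (baseCopy F ∪ G ×ˢ ({h} : Set ℝ)) ∈ CCSF F := by
  refine ⟨isCompact_convexHull_baseCopy_union hF hG hF0 hG0 hFc hGc h, convex_convexHull ℝ _,
    ⟨?_, ?_⟩, hvol⟩
  · rintro ⟨x, t⟩ hx
    exact ((slice_convexHull_baseCopy_union hF hG hF0 hG0 hh).1 hx).1.1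
  · ext ⟨x, t⟩
    constructor
    · rintro ⟨hx, ht⟩
      have ht' : t = 0 := ht
      subst ht'
      have := ((slice_convexHull_baseCopy_union hF hG hF0 hG0 hh).1 hx).2
      simp only [zero_div, sub_zero, one_smul, zero_smul_set hG0, add_zero] at this
      exact ⟨this, rfl⟩
    · intro hx
      exact ⟨subset_convexHull ℝ _ (Or.inl hx), hx.2⟩

theorem volume_convexHull_baseCopy_union (hF : Convex ℝ F) (hG : Convex ℝ G) (hF0 : F.Nonempty)
    (hG0 : G.Nonempty) (hFc : IsCompact F) (hGc : IsCompact G) {h : ℝ} (hh : 0 < h) :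
    volume (convexHull ℝ (baseCopy F ∪ G ×ˢ ({h} : Set ℝ)) : Set (Space d)) =
      ∫⁻ t in Icc 0 h, volume ((1 - t / h) • F + (t / h) • G) := by
  have hc := isCompact_convexHull_baseCopy_union hF hG hF0 hG0 hFc hGc h
  rw [volume_eq_lintegral_slice hc.measurableSet,
    ← lintegral_indicator measurableSet_Icc]
  refine lintegral_congr fun t => ?_
  by_cases ht : t ∈ Icc 0 h
  · rw [indicator_of_mem ht]
    congr 1; ext x
    exact (slice_convexHull_baseCopy_union hF hG hF0 hG0 hh).trans (and_iff_right ht)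
  · rw [indicator_of_notMem ht]
    convert measure_empty (μ := (volume : Measure (Fin (d - 1) → ℝ)))
    ext x
    simp only [mem_ofPred_eq, mem_empty_iff_false, iff_false]
    exact fun hx => ht ((slice_convexHull_baseCopy_union hF hG hF0 hG0 hh).1 hx).1

/-! ### Mountains -/

theorem mountain_eq (F : Set (Fin (d - 1) → ℝ)) (z : Space d) :
    Mountain F z = convexHull ℝ (baseCopy F ∪ ({z.1} : Set (Fin (d - 1) → ℝ)) ×ˢ {z.2}) := by
  rw [Mountain, union_comm, singleton_prod_singleton]

theorem mem_mountain (hF : Convex ℝ F) (hF0 : F.Nonempty) {x z : Space d} :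
    x ∈ Mountain F z ↔
      ∃ s ∈ Icc (0 : ℝ) 1, ∃ f ∈ F, x = ((1 - s) • f + s • z.1, s * z.2) := by
  rw [mountain_eq, mem_convexHull_baseCopy_union hF (convex_singleton _) hF0 (singleton_nonempty _)]
  simp

theorem volume_slice_mountain (hFvol : volume F = 1) {s : ℝ} (hs : s ≤ 1) (y : Fin (d - 1) → ℝ) :
    volume ((1 - s) • F + s • ({y} : Set (Fin (d - 1) → ℝ))) = ENNReal.ofReal ((1 - s) ^ (d - 1)) := by
  rw [smul_set_singleton, add_singleton, image_add_right, measure_preimage_add_right,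
    volume_smul_eq (by linarith), hFvol, mul_one]

theorem volume_mountain (hd : 2 ≤ d) (hF : Convex ℝ F) (hFc : IsCompact F) (hFvol : volume F = 1)
    {z : Space d} (hz : 0 ≤ z.2) : volume (Mountain F z) = ENNReal.ofReal (z.2 / d) := by
  have hF0 : F.Nonempty := nonempty_of_measure_ne_zero (μ := volume) (by simp [hFvol])
  rcases hz.eq_or_lt with hz | hz
  · rw [← hz]
    simp only [zero_div, ENNReal.ofReal_zero]
    refine measure_mono_null (fun x hx => ?_) (volume_height_eq 0)
    obtain ⟨s, -, f, -, rfl⟩ := (mem_mountain hF hF0).1 hx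
    simp [← hz]
  · rw [mountain_eq, volume_convexHull_baseCopy_union hF (convex_singleton _) hF0
      (singleton_nonempty _) hFc isCompact_singleton hz]
    calc _ = ∫⁻ t in Icc 0 z.2, ENNReal.ofReal ((1 - t / z.2 + t / z.2 * 0) ^ (d - 1)) := by
          refine setLIntegral_congr_fun measurableSet_Icc fun t ht => ?_
          simp only [volume_slice_mountain hFvol ((div_le_one hz).2 ht.2), mul_zero, add_zero]
      _ = _ := by
        rw [lintegral_Icc_frustum le_rfl hz, frustumFactor_zero, Nat.cast_sub (by lia)]
        simp [div_eq_mul_inv]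

/-- The part of the mountain with apex `z` strictly between floor and apex that lies over `G`:
the open segments from points `(g, 0)`, `g ∈ G`, to `z`. It is written as a condition on the point
where the line through `z` meets the hyperplane of height zero. -/
def OpenCone (G : Set (Fin (d - 1) → ℝ)) (z : Space d) : Set (Space d) :=
  {x | 0 < x.2 ∧ x.2 < z.2 ∧ (1 - x.2 / z.2)⁻¹ • (x.1 - (x.2 / z.2) • z.1) ∈ G}

theorem openCone_subset_mountain (hF : Convex ℝ F) (hF0 : F.Nonempty) (hG : G ⊆ F) (z : Space d) :
    OpenCone G z ⊆ Mountain F z := by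
  rintro x ⟨h0, h1, hx⟩
  have hz : 0 < z.2 := h0.trans h1
  have hs : x.2 / z.2 < 1 := (div_lt_one hz).2 h1
  refine (mem_mountain hF hF0).2 ⟨x.2 / z.2, ⟨by positivity, hs.le⟩, _, hG hx, ?_⟩
  rw [smul_smul, mul_inv_cancel₀ (sub_pos.2 hs).ne']
  ext <;> simp [hz.ne']

/-- Joint openness in point and apex. It is what makes the event “one point is strictly below the
mountain over the other” measurable in the product space. -/
theorem isOpen_setOf_mem_openCone (hG : IsOpen G) :
    IsOpen {p : Space d × Space d | p.1 ∈ OpenCone G p.2} := by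
  have hU : IsOpen {p : Space d × Space d | 0 < p.1.2 ∧ p.1.2 < p.2.2} :=
    IsOpen.and (isOpen_lt (by fun_prop) (by fun_prop)) (isOpen_lt (by fun_prop) (by fun_prop))
  have hc : ContinuousOn (fun p : Space d × Space d =>
      (1 - p.1.2 / p.2.2)⁻¹ • (p.1.1 - (p.1.2 / p.2.2) • p.2.1))
      {p : Space d × Space d | 0 < p.1.2 ∧ p.1.2 < p.2.2} := by
    have hdiv : ContinuousOn (fun p : Space d × Space d => p.1.2 / p.2.2)
        {p : Space d × Space d | 0 < p.1.2 ∧ p.1.2 < p.2.2} :=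
      ContinuousOn.div (by fun_prop) (by fun_prop) fun p hp => (hp.1.trans hp.2).ne'
    refine ContinuousOn.smul (ContinuousOn.inv₀ (continuousOn_const.sub hdiv) fun p hp => ?_) ?_
    · have : p.1.2 / p.2.2 < 1 := (div_lt_one (hp.1.trans hp.2)).2 hp.2
      exact (sub_pos.2 this).ne'
    · exact ContinuousOn.sub (by fun_prop) (hdiv.smul (by fun_prop))
  convert hc.isOpen_inter_preimage hU hG using 1
  ext p
  simp [OpenCone, and_assoc]

theorem isOpen_openCone (hG : IsOpen G) (z : Space d) : IsOpen (OpenCone G z) :=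
  (isOpen_setOf_mem_openCone hG).preimage (Continuous.prodMk_left z)

/-- For `G` the interior of `F`, the open cone has the full volume of the mountain. -/
theorem volume_openCone (hd : 2 ≤ d) (hG : IsOpen G) (hGvol : volume G = 1) {z : Space d}
    (hz : 0 ≤ z.2) : volume (OpenCone G z) = ENNReal.ofReal (z.2 / d) := by
  rcases hz.eq_or_lt with hz | hz
  · have : OpenCone G z = ∅ := by
      ext x; simp only [OpenCone, ← hz, mem_ofPred_eq, mem_empty_iff_false, iff_false]
      rintro ⟨h0, h1, -⟩; linarith
    simp [this, ← hz]
  rw [volume_eq_lintegral_slice (isOpen_openCone hG z).measurableSet]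
  calc _ = ∫⁻ t in Ioo 0 z.2, ENNReal.ofReal ((1 - t / z.2 + t / z.2 * 0) ^ (d - 1)) := by
        rw [← lintegral_indicator measurableSet_Ioo]
        refine lintegral_congr fun t => ?_
        by_cases ht : t ∈ Ioo 0 z.2
        · have hs : 0 < 1 - t / z.2 := sub_pos.2 ((div_lt_one hz).2 ht.2)
          rw [indicator_of_mem ht]
          have : {x | ((x, t) : Space d) ∈ OpenCone G z} =
              (fun x => x - (t / z.2) • z.1) ⁻¹' ((fun x => (1 - t / z.2)⁻¹ • x) ⁻¹' G) := by
            ext x; simp [OpenCone, ht.1, ht.2]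
          simp only [sub_eq_add_neg] at this hs ⊢
          rw [this, measure_preimage_add_right, Measure.addHaar_preimage_smul _ (by positivity),
            hGvol]
          simp [abs_of_pos hs]
        · rw [indicator_of_notMem ht]
          convert measure_empty (μ := (volume : Measure (Fin (d - 1) → ℝ)))
          ext x
          simp only [mem_ofPred_eq, mem_empty_iff_false, iff_false]
          exact fun hx => ht ⟨hx.1, hx.2.1⟩
    _ = ∫⁻ t in Icc 0 z.2, ENNReal.ofReal ((1 - t / z.2 + t / z.2 * 0) ^ (d - 1)) := by
        rw [Measure.restrict_congr_set Ioo_ae_eq_Icc]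
    _ = _ := by
      rw [lintegral_Icc_frustum le_rfl hz, frustumFactor_zero, Nat.cast_sub (by lia)]
      simp [div_eq_mul_inv]

theorem isCompact_setOf_mem_mountain (hF : Convex ℝ F) (hF0 : F.Nonempty) (hFc : IsCompact F)
    {K : Set (Space d)} (hK : IsCompact K) :
    IsCompact {p : Space d × Space d | p.2 ∈ K ∧ p.1 ∈ Mountain F p.2} := by
  have : {p : Space d × Space d | p.2 ∈ K ∧ p.1 ∈ Mountain F p.2} =
      (fun q : (ℝ × (Fin (d - 1) → ℝ)) × Space d =>
        ((((1 - q.1.1) • q.1.2 + q.1.1 • q.2.1, q.1.1 * q.2.2) : Space d), q.2)) ''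
          ((Icc 0 1 ×ˢ F) ×ˢ K) := by
    ext ⟨x, z⟩
    simp only [mem_ofPred_eq, mem_mountain hF hF0]
    constructor
    · rintro ⟨hz, s, hs, f, hf, rfl⟩
      exact ⟨((s, f), z), ⟨⟨hs, hf⟩, hz⟩, rfl⟩
    · rintro ⟨⟨⟨s, f⟩, w⟩, ⟨⟨hs, hf⟩, hw⟩, e⟩
      obtain ⟨rfl, rfl⟩ := Prod.mk.inj e
      exact ⟨hw, s, hs, f, hf, rfl⟩
  rw [this]
  exact ((isCompact_Icc.prod hFc).prod hK).image (by fun_prop)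

end

/-! ### The boundary event -/

/-- A point added to a convex set `s` which lands in the interior of the hull was already in `s`. -/
theorem mem_of_mem_interior_convexHull_insert {E : Type*} [AddCommGroup E] [Module ℝ E]
    [TopologicalSpace E] [IsTopologicalAddGroup E] [ContinuousSMul ℝ E] {s : Set E}
    (hs : Convex ℝ s) (hs0 : s.Nonempty) {x : E} (hx : x ∈ interior (convexHull ℝ (insert x s))) :
    x ∈ s := by
  obtain ⟨m, hm⟩ := hs0
  have hc : Filter.Tendsto (fun ε : ℝ => x + ε • (x - m)) (nhdsWithin 0 (Ioi 0)) (nhds x) := by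
    have : Continuous fun ε : ℝ => x + ε • (x - m) := by fun_prop
    exact (by simpa using this.tendsto 0 : Filter.Tendsto _ _ (nhds x)).mono_left nhdsWithin_le_nhds
  -- push `x` a little away from `m ∈ s`; writing the new point with `x` and `m' ∈ s` and solving
  -- for `x` displays it as a convex combination of `m` and `m'`
  obtain ⟨ε, hε, hε0⟩ := ((hc.eventually (mem_interior_iff_mem_nhds.1 hx)).and
    self_mem_nhdsWithin).exists
  have hε0 : 0 < ε := hε0
  have hε : x + ε • (x - m) ∈ convexHull ℝ (insert x s) := hε
  rw [convexHull_insert ⟨m, hm⟩, hs.convexHull_eq, mem_convexJoin] at hε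
  obtain ⟨x', hx', m', hm', a, b, ha, hb, hab, e⟩ := hε
  rw [mem_singleton_iff] at hx'
  rw [hx'] at e
  clear hx'
  have hb' : 0 < ε + b := by linarith
  have : x = (ε / (ε + b)) • m + (b / (ε + b)) • m' := by
    have h1 : (ε + b) • x = ε • m + b • m' := by
      have ha' : a = 1 - b := by linarith
      subst ha'
      linear_combination (norm := module) (-1 : ℝ) • e
    rw [div_eq_inv_mul, div_eq_inv_mul, mul_smul, mul_smul, ← smul_add, ← h1, smul_smul,
      inv_mul_cancel₀ hb'.ne', one_smul]
  rw [this]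
  exact hs hm hm' (by positivity) (by positivity) (by field_simp)

section
variable {d : ℕ} {F : Set (Fin (d - 1) → ℝ)}

/-- The event whose probability is `Q F K`. -/
def boundaryEvent (F : Set (Fin (d - 1) → ℝ)) : Set (Space d × Space d) :=
  {p | p.1 ∈ frontier (convexHull ℝ (baseCopy F ∪ {p.1, p.2})) ∧
       p.2 ∈ frontier (convexHull ℝ (baseCopy F ∪ {p.1, p.2}))}

theorem mem_mountain_of_mem_interior {x z : Space d}
    (h : x ∈ interior (convexHull ℝ (baseCopy F ∪ {x, z}))) : x ∈ Mountain F z := by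
  refine mem_of_mem_interior_convexHull_insert (s := Mountain F z) (convex_convexHull ℝ _)
    ⟨z, subset_convexHull ℝ _ (Or.inl rfl)⟩ ?_
  refine interior_mono (convexHull_min ?_ (convex_convexHull ℝ _)) h
  have hM : Mountain F z ⊆ convexHull ℝ (insert x (Mountain F z)) :=
    (subset_insert _ _).trans (subset_convexHull ℝ _)
  rintro y (hy | rfl | rfl)
  · exact hM (subset_convexHull ℝ _ (Or.inr hy))
  · exact subset_convexHull ℝ _ (mem_insert _ _)
  · exact hM (subset_convexHull ℝ _ (Or.inl rfl))

/-- If one of the two points is interior to the hull, it lies in the mountain over the other one. -/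
theorem mem_mountain_or_of_notMem_boundaryEvent {p : Space d × Space d}
    (hp : p ∉ boundaryEvent F) : p.1 ∈ Mountain F p.2 ∨ p.2 ∈ Mountain F p.1 := by
  obtain ⟨x, z⟩ := p
  have hint : ∀ y ∈ ({x, z} : Set (Space d)),
      y ∉ frontier (convexHull ℝ (baseCopy F ∪ {x, z})) →
      y ∈ interior (convexHull ℝ (baseCopy F ∪ {x, z})) := by
    intro y hy hyf
    by_contra hyi
    exact hyf ⟨subset_closure (subset_convexHull ℝ _ (Or.inr hy)), hyi⟩
  rcases not_and_or.1 hp with h | h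
  · exact Or.inl (mem_mountain_of_mem_interior (hint x (by simp) h))
  · refine Or.inr (mem_mountain_of_mem_interior ?_)
    have := hint z (by simp) h
    rwa [pair_comm] at this

theorem notMem_boundaryEvent_of_mem_openCone (hF : Convex ℝ F) (hF0 : F.Nonempty)
    {p : Space d × Space d}
    (hp : p.1 ∈ OpenCone (interior F) p.2 ∨ p.2 ∈ OpenCone (interior F) p.1) :
    p ∉ boundaryEvent F := by
  have key : ∀ x z : Space d, x ∈ OpenCone (interior F) z → ∀ s : Set (Space d), z ∈ s →
      x ∈ interior (convexHull ℝ (baseCopy F ∪ s)) := by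
    intro x z hx s hz
    refine interior_maximal ?_ (isOpen_openCone isOpen_interior z) hx
    refine (openCone_subset_mountain hF hF0 interior_subset z).trans (convexHull_mono ?_)
    exact union_subset (by simpa using Or.inr hz) subset_union_left
  rintro ⟨h1, h2⟩
  rcases hp with hp | hp
  · exact h1.2 (key _ _ hp _ (by simp))
  · exact h2.2 (key _ _ hp _ (by simp))

theorem mountain_subset {K : Set (Space d)} (hK : K ∈ CCSF F) {z : Space d}
    (hz : z ∈ K) : Mountain F z ⊆ K := by
  refine convexHull_min ?_ hK.2.1
  rintro x (rfl | hx)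
  · exact hz
  · rw [← hK.2.2.1.2] at hx
    exact hx.1

theorem integrableOn_height {K : Set (Space d)} (hK : IsCompact K) :
    IntegrableOn (fun x : Space d => x.2) K :=
  continuous_snd.continuousOn.integrableOn_compact hK

/-- The boundary probability is an affine decreasing function of the mean height. The complement of
the boundary event lies between the union of two disjoint open events and the union of two compact
events. All four have probability `∫ x in K, x.2 / d`, the mean volume of the mountain over a
uniform point, so the boundary event itself need not be shown measurable. -/
theorem Q_eq (hd : 2 ≤ d) (hFc : IsCompact F) (hF : Convex ℝ F) (hFvol : volume F = 1)
    {K : Set (Space d)} (hK : K ∈ CCSF F) :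
    Q F K = 1 - 2 / d * ∫ x in K, x.2 := by
  have hF0 : F.Nonempty := nonempty_of_measure_ne_zero (μ := volume) (by simp [hFvol])
  obtain ⟨hKc, hKconv, hKfl, hKvol⟩ := id hK
  have hKm : MeasurableSet K := hKc.measurableSet
  set μ : Measure (Space d) := volume.restrict K with hμ
  have hunif : unif K = μ := by simp [unif, ProbabilityTheory.cond, hKvol, hμ]
  have : IsProbabilityMeasure μ := ⟨by simp [hμ, hKvol]⟩
  have hint : volume (interior F) = 1 := by
    rw [← hFvol]
    refine le_antisymm (measure_mono interior_subset) ?_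
    calc volume F ≤ volume (interior F ∪ frontier F) := measure_mono (by
          rw [← closure_eq_interior_union_frontier]; exact subset_closure)
      _ ≤ volume (interior F) + volume (frontier F) := measure_union_le _ _
      _ = _ := by rw [hF.addHaar_frontier volume, add_zero]
  set I : ℝ≥0∞ := ∫⁻ z, ENNReal.ofReal (z.2 / d) ∂μ with hI
  -- `O`, `C` and their swaps are the open and the compact events that sandwich the complement
  set O : Set (Space d × Space d) := {p | p.1 ∈ OpenCone (interior F) p.2} with hO
  set C : Set (Space d × Space d) := {p | p.2 ∈ K ∧ p.1 ∈ Mountain F p.2} with hC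
  have hOm : MeasurableSet O := (isOpen_setOf_mem_openCone isOpen_interior).measurableSet
  have hCm : MeasurableSet C := (isCompact_setOf_mem_mountain hF hF0 hFc hKc).measurableSet
  have hOI : (μ.prod μ) O = I := by
    rw [Measure.prod_apply_symm hOm]
    refine setLIntegral_congr_fun hKm fun z hz => ?_
    have e : (fun x => (x, z)) ⁻¹' O = OpenCone (interior F) z := rfl
    simp only [e]
    rw [Measure.restrict_eq_self _ ((openCone_subset_mountain hF hF0 interior_subset z).trans
      (mountain_subset hK hz)), volume_openCone hd isOpen_interior hint (hKfl.1 z hz)]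
  have hCI : (μ.prod μ) C = I := by
    rw [Measure.prod_apply_symm hCm]
    refine setLIntegral_congr_fun hKm fun z hz => ?_
    have e : (fun x => (x, z)) ⁻¹' C = Mountain F z := by ext; simp [hC, hz]
    simp only [e]
    rw [Measure.restrict_eq_self _ (mountain_subset hK hz),
      volume_mountain hd hF hFc hFvol (hKfl.1 z hz)]
  have swap : ∀ A, MeasurableSet A → (μ.prod μ) (Prod.swap ⁻¹' A) = (μ.prod μ) A := fun A hA =>
    Measure.measurePreserving_swap.measure_preimage hA.nullMeasurableSet
  have hdis : Disjoint O (Prod.swap ⁻¹' O) := by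
    rw [Set.disjoint_left]
    intro p hp hp'
    exact lt_asymm hp.2.1 hp'.2.1
  have hOm' : MeasurableSet (Prod.swap ⁻¹' O) := measurable_swap hOm
  have upper : (μ.prod μ) (boundaryEvent F) + 2 * I ≤ 1 := by
    have h2 : (μ.prod μ) (O ∪ Prod.swap ⁻¹' O) = 2 * I := by
      rw [measure_union hdis hOm', swap O hOm, hOI, two_mul]
    rw [← h2, ← measure_union _ (hOm.union hOm')]
    · exact prob_le_one
    · rw [Set.disjoint_left]
      intro p hp hp'
      exact notMem_boundaryEvent_of_mem_openCone hF hF0 hp' hp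
  have lower : 1 ≤ (μ.prod μ) (boundaryEvent F) + 2 * I := by
    have hcov : (K ×ˢ K : Set (Space d × Space d)) ⊆
        boundaryEvent F ∪ (C ∪ Prod.swap ⁻¹' C) := by
      intro p hp
      by_cases h : p ∈ boundaryEvent F
      · exact Or.inl h
      · rcases mem_mountain_or_of_notMem_boundaryEvent h with h | h
        · exact Or.inr (Or.inl ⟨hp.2, h⟩)
        · exact Or.inr (Or.inr ⟨hp.1, h⟩)
    calc (1 : ℝ≥0∞) = (μ.prod μ) (K ×ˢ K) := by
          rw [Measure.prod_prod, hμ, Measure.restrict_apply_self, hKvol, one_mul]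
      _ ≤ _ := measure_mono hcov
      _ ≤ (μ.prod μ) (boundaryEvent F) + ((μ.prod μ) C + (μ.prod μ) (Prod.swap ⁻¹' C)) :=
        (measure_union_le _ _).trans (by gcongr; exact measure_union_le _ _)
      _ = _ := by rw [swap C hCm, hCI, two_mul]
  have hsum : (μ.prod μ) (boundaryEvent F) + 2 * I = 1 := le_antisymm upper lower
  have hIr : I = ENNReal.ofReal ((∫ x in K, x.2) / d) := by
    rw [hI, ← ofReal_integral_eq_lintegral_ofReal, integral_div]
    · exact (integrableOn_height hKc).div_const _
    · filter_upwards [ae_restrict_mem hKm] with z hz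
      exact div_nonneg (hKfl.1 z hz) (Nat.cast_nonneg d)
  have hnn : 0 ≤ (∫ x in K, x.2) / d :=
    div_nonneg (setIntegral_nonneg hKm fun x hx => hKfl.1 x hx) (Nat.cast_nonneg d)
  have hreal : ((μ.prod μ) (boundaryEvent F)).toReal + 2 * ((∫ x in K, x.2) / d) = 1 := by
    have := congrArg ENNReal.toReal hsum
    rw [ENNReal.toReal_add (measure_ne_top _ _)
      (by rw [hIr]; exact ENNReal.mul_ne_top (by simp) (by simp)), hIr] at this
    simpa [ENNReal.toReal_ofReal hnn] using this
  have : Q F K = ((μ.prod μ) (boundaryEvent F)).toReal := by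
    rw [Q, hunif]; rfl
  rw [this]
  linear_combination hreal

theorem integral_height_pos {K : Set (Space d)} (hK : K ∈ CCSF F) : 0 < ∫ x in K, x.2 := by
  obtain ⟨hKc, hKconv, hKfl, hKvol⟩ := hK
  rw [setIntegral_pos_iff_support_of_nonneg_ae _ (integrableOn_height hKc)]
  · have : K ⊆ (Function.support (fun x : Space d => x.2) ∩ K) ∪ {x | x.2 = 0} := by
      intro x hx
      by_cases h : x.2 = 0
      · exact Or.inr h
      · exact Or.inl ⟨h, hx⟩
    have := (measure_mono (μ := volume) this).trans (measure_union_le _ _)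
    rw [hKvol, volume_height_eq, add_zero] at this
    exact one_pos.trans_le this
  · filter_upwards [ae_restrict_mem hKc.measurableSet] with z hz using hKfl.1 z hz

/-! ### Comparison with the unit mountain -/

theorem integral_height_eq_slice {K : Set (Space d)} (hK : IsCompact K) :
    Integrable (fun t : ℝ => t * (volume {x | ((x, t) : Space d) ∈ K}).toReal) ∧
    ∫ x in K, x.2 = ∫ t : ℝ, t * (volume {x | ((x, t) : Space d) ∈ K}).toReal := by
  have hi : Integrable (K.indicator fun x : Space d => x.2) (volume.prod volume) :=
    (integrableOn_height hK).integrable_indicator hK.measurableSet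
  have e : ∀ t : ℝ, ∫ x, K.indicator (fun x : Space d => x.2) (x, t) =
      t * (volume {x | ((x, t) : Space d) ∈ K}).toReal := by
    intro t
    have : (fun x => K.indicator (fun x : Space d => x.2) (x, t)) =
        {x | ((x, t) : Space d) ∈ K}.indicator fun _ => t := by
      ext x; by_cases h : ((x, t) : Space d) ∈ K <;> simp [h]
    rw [this, integral_indicator_const _ (measurableSet_slice hK.measurableSet t)]
    simp [Measure.real, mul_comm]
  constructor
  · simpa only [e] using hi.integral_prod_right
  · rw [← integral_indicator hK.measurableSet, Measure.volume_eq_prod, integral_prod_symm _ hi]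
    simp only [e]

theorem integral_slice {K : Set (Space d)} (hK : IsCompact K) :
    Integrable (fun t : ℝ => (volume {x | ((x, t) : Space d) ∈ K}).toReal) ∧
    ∫ t : ℝ, (volume {x | ((x, t) : Space d) ∈ K}).toReal = (volume K).toReal := by
  have hm : Measurable fun t : ℝ => volume {x | ((x, t) : Space d) ∈ K} :=
    measurable_measure_prodMk_right hK.measurableSet
  have h := volume_eq_lintegral_slice hK.measurableSet
  have hfin : ∫⁻ t : ℝ, volume {x | ((x, t) : Space d) ∈ K} ≠ ∞ := h ▸ hK.measure_lt_top.ne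
  refine ⟨integrable_toReal_of_lintegral_ne_top hm.aemeasurable hfin, ?_⟩
  rw [integral_toReal hm.aemeasurable (ae_lt_top hm hfin), ← h]

/-- Brunn's theorem between the floor and the slice at height `t`. -/
theorem slice_volume_ge {K : Set (Space d)} (hFc : IsCompact F) (hFvol : volume F = 1)
    (hK : K ∈ CCSF F) {s t v : ℝ} (hs : 0 < s) (hst : s < t) (hv : 0 < v)
    (ht : volume {x | ((x, t) : Space d) ∈ K} = ENNReal.ofReal (v ^ (d - 1))) :
    ENNReal.ofReal ((1 - s / t + s / t * v) ^ (d - 1)) ≤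
      volume {x | ((x, s) : Space d) ∈ K} := by
  have ht0 : 0 < t := hs.trans hst
  have h1 : s / t < 1 := (div_lt_one ht0).2 hst
  have hKm := hK.1.measurableSet
  refine brunnMinkowski (sub_pos.2 h1) (div_pos hs ht0) hv hFc.measurableSet
    (measurableSet_slice hKm t) (measurableSet_slice hKm s) hFvol ht fun x hx y hy => ?_
  have hx' : ((x, 0) : Space d) ∈ K := by
    have : ((x, 0) : Space d) ∈ baseCopy F := ⟨hx, rfl⟩
    rw [← hK.2.2.1.2] at this
    exact this.1
  have := hK.2.1 hx' hy (sub_pos.2 h1).le (div_pos hs ht0).le (by ring)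
  simpa [ht0.ne'] using this

theorem isCompact_slice {K : Set (Space d)} (hK : IsCompact K) (t : ℝ) :
    IsCompact {x | ((x, t) : Space d) ∈ K} := by
  have : {x | ((x, t) : Space d) ∈ K} = Prod.fst '' (K ∩ {x | x.2 = t}) := by
    ext x
    constructor
    · intro hx; exact ⟨(x, t), ⟨hx, rfl⟩, rfl⟩
    · rintro ⟨⟨y, s⟩, ⟨hy, hs⟩, rfl⟩
      have hs : s = t := hs
      subst hs; exact hy
  rw [this]
  exact (hK.inter_right (isClosed_eq continuous_snd continuous_const)).image continuous_fst

theorem slice_eq_empty_of_neg {K : Set (Space d)} (hK : K ∈ CCSF F) {t : ℝ} (ht : t < 0) :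
    {x | ((x, t) : Space d) ∈ K} = ∅ := by
  ext x
  simp only [mem_ofPred_eq, mem_empty_iff_false, iff_false]
  exact fun hx => ht.not_ge (hK.2.2.1.1 _ hx)

theorem slice_zero {K : Set (Space d)} (hK : K ∈ CCSF F) :
    {x | ((x, 0) : Space d) ∈ K} = F := by
  ext x
  have : ((x, 0) : Space d) ∈ K ∩ {x | x.2 = 0} ↔ ((x, 0) : Space d) ∈ baseCopy F := by
    rw [hK.2.2.1.2]
  simpa [baseCopy] using this

theorem volume_mountain_slice (hd : 2 ≤ d) (hF : Convex ℝ F) (hFvol : volume F = 1) {z : Space d}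
    (hz : 0 < z.2) {t : ℝ} (ht : 0 ≤ t) :
    (volume {x | ((x, t) : Space d) ∈ Mountain F z}).toReal = max 0 (1 - t / z.2) ^ (d - 1) := by
  have hF0 : F.Nonempty := nonempty_of_measure_ne_zero (μ := volume) (by simp [hFvol])
  have hiff := @slice_convexHull_baseCopy_union d F {z.1} hF (convex_singleton _) hF0
    (singleton_nonempty _) z.2 hz
  rcases le_or_gt t z.2 with h | h
  · have h1 : t / z.2 ≤ 1 := (div_le_one hz).2 h
    have : {x | ((x, t) : Space d) ∈ Mountain F z} =
        (1 - t / z.2) • F + (t / z.2) • ({z.1} : Set (Fin (d - 1) → ℝ)) := by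
      ext x
      rw [mountain_eq]
      exact hiff.trans (and_iff_right ⟨ht, h⟩)
    rw [this, volume_slice_mountain hFvol h1, max_eq_right (sub_nonneg.2 h1),
      ENNReal.toReal_ofReal (pow_nonneg (sub_nonneg.2 h1) _)]
  · have h1 : 1 < t / z.2 := (one_lt_div hz).2 h
    have : {x | ((x, t) : Space d) ∈ Mountain F z} = ∅ := by
      ext x
      rw [mountain_eq]
      simp only [mem_empty_iff_false, iff_false]
      exact fun hx => h.not_ge (hiff.1 hx).1.2
    rw [this, max_eq_left (by linarith), zero_pow (by lia)]
    simp

/-- If the slice of `K` at height `t` is at least as large as that of the mountain with apex height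
`h`, the same holds at all lower heights. -/
theorem slice_domination_antitone {K : Set (Space d)} (hd : 2 ≤ d) (hFc : IsCompact F)
    (hFvol : volume F = 1) (hK : K ∈ CCSF F) {h : ℝ} (hh : 0 < h) {s t : ℝ} (hs : 0 < s)
    (hst : s < t) (ht0 : 0 < (volume {x | ((x, t) : Space d) ∈ K}).toReal)
    (ht : max 0 (1 - t / h) ^ (d - 1) ≤ (volume {x | ((x, t) : Space d) ∈ K}).toReal) :
    0 < (volume {x | ((x, s) : Space d) ∈ K}).toReal ∧
      max 0 (1 - s / h) ^ (d - 1) ≤ (volume {x | ((x, s) : Space d) ∈ K}).toReal := by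
  have hn : d - 1 ≠ 0 := by lia
  set a := (volume {x | ((x, t) : Space d) ∈ K}).toReal with ha
  set v := a ^ ((d - 1 : ℕ) : ℝ)⁻¹ with hv
  have hv0 : 0 < v := Real.rpow_pos_of_pos ht0 _
  have hvn : v ^ (d - 1) = a := Real.rpow_inv_natCast_pow ht0.le hn
  have hvt : 1 - t / h ≤ v := by
    rw [← hvn, pow_le_pow_iff_left₀ (le_max_left _ _) hv0.le hn] at ht
    exact (le_max_right _ _).trans ht
  have key := slice_volume_ge hFc hFvol hK hs hst hv0 (by
    rw [hvn, ha, ENNReal.ofReal_toReal (isCompact_slice hK.1 t).measure_lt_top.ne])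
  rw [ENNReal.ofReal_le_iff_le_toReal (isCompact_slice hK.1 s).measure_lt_top.ne] at key
  have ht' : 0 < t := hs.trans hst
  have hr : s / t < 1 := (div_lt_one ht').2 hst
  have hr0 : 0 < s / t := div_pos hs ht'
  have hpos : 0 < 1 - s / t + s / t * v := by nlinarith [mul_pos hr0 hv0]
  refine ⟨(pow_pos hpos _).trans_le key, le_trans ?_ key⟩
  refine pow_le_pow_left₀ (le_max_left _ _) (max_le hpos.le ?_) _
  have : s / t * (1 - t / h) = s / t - s / h := by field_simp
  have := mul_le_mul_of_nonneg_left hvt hr0.le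
  linarith

/-- A unit mountain has the largest mean height. With `a`, `b` the slice volumes of `K` and of the
mountain, there is a height `t₀` with `b ≤ a` below and `a ≤ b` above it, so
`(t - t₀) * (a t - b t) ≤ 0` everywhere; integrating, the two unit volumes cancel. -/
theorem integral_height_le {K : Set (Space d)} (hd : 2 ≤ d) (hFc : IsCompact F) (hF : Convex ℝ F)
    (hFvol : volume F = 1) (hK : K ∈ CCSF F) {z : Space d} (hz : 0 < z.2)
    (hM : Mountain F z ∈ CCSF F) :
    ∫ x in K, x.2 ≤ ∫ x in Mountain F z, x.2 := by
  obtain ⟨iK, eK⟩ := integral_height_eq_slice hK.1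
  obtain ⟨iM, eM⟩ := integral_height_eq_slice hM.1
  obtain ⟨jK, fK⟩ := integral_slice hK.1
  obtain ⟨jM, fM⟩ := integral_slice hM.1
  rw [hK.2.2.2] at fK
  rw [hM.2.2.2] at fM
  rw [eK, eM]
  set a : ℝ → ℝ := fun t => (volume {x | ((x, t) : Space d) ∈ K}).toReal with ha
  set b : ℝ → ℝ := fun t => (volume {x | ((x, t) : Space d) ∈ Mountain F z}).toReal with hb
  have hbt : ∀ t, 0 ≤ t → b t = max 0 (1 - t / z.2) ^ (d - 1) := fun t ht =>
    volume_mountain_slice hd hF hFvol hz ht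
  have ha0 : a 0 = 1 := by simp [ha, slice_zero hK, hFvol]
  have hb0 : b 0 = 1 := by simp [hb, slice_zero hM, hFvol]
  have han : ∀ t < 0, a t = 0 := fun t ht => by simp [ha, slice_eq_empty_of_neg hK ht]
  have hbn : ∀ t < 0, b t = 0 := fun t ht => by simp [hb, slice_eq_empty_of_neg hM ht]
  have hapos : ∀ t, 0 ≤ a t := fun t => ENNReal.toReal_nonneg
  have hbpos : ∀ t, 0 ≤ b t := fun t => ENNReal.toReal_nonneg
  -- `0 < a t` excludes the heights above both sets, so that `T` is bounded
  set T : Set ℝ := {t | 0 ≤ t ∧ 0 < a t ∧ b t ≤ a t} with hT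
  have hT0 : (0 : ℝ) ∈ T := ⟨le_rfl, by rw [ha0]; exact one_pos, by rw [ha0, hb0]⟩
  have hTbdd : BddAbove T := by
    obtain ⟨B, hB⟩ := (hK.1.image continuous_snd).bddAbove
    refine ⟨B, fun t ht => ?_⟩
    have : (volume {x | ((x, t) : Space d) ∈ K}) ≠ 0 := fun h => by
      have := ht.2.1
      simp [ha, h] at this
    obtain ⟨x, hx⟩ := nonempty_of_measure_ne_zero this
    exact hB ⟨_, hx, rfl⟩
  have hdown : ∀ t ∈ T, ∀ s, 0 ≤ s → s < t → s ∈ T := by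
    intro t ht s hs hst
    rcases hs.eq_or_lt with rfl | hs'
    · exact hT0
    have := slice_domination_antitone hd hFc hFvol hK hz hs' hst ht.2.1 (hbt t ht.1 ▸ ht.2.2)
    exact ⟨hs, this.1, by rw [hbt s hs]; exact this.2⟩
  set t₀ := sSup T
  have hpt : ∀ t, (t - t₀) * a t ≤ (t - t₀) * b t := by
    intro t
    rcases lt_or_ge t 0 with h | h
    · simp [han t h, hbn t h]
    rcases lt_trichotomy t t₀ with h' | h' | h'
    · obtain ⟨u, hu, htu⟩ := exists_lt_of_lt_csSup ⟨0, hT0⟩ h'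
      exact mul_le_mul_of_nonpos_left (hdown u hu t h htu).2.2 (by linarith)
    · simp [h']
    · refine mul_le_mul_of_nonneg_left ?_ (by linarith)
      by_contra! hlt
      exact h'.not_ge (le_csSup hTbdd ⟨h, (hbpos t).trans_lt hlt, hlt.le⟩)
  have hint := integral_mono (μ := volume) (f := fun t => (t - t₀) * a t)
    (g := fun t => (t - t₀) * b t)
    (by simp only [sub_mul]; exact iK.sub (jK.const_mul t₀))
    (by simp only [sub_mul]; exact iM.sub (jM.const_mul t₀)) hpt
  simp only [sub_mul] at hint
  rw [integral_sub iK (jK.const_mul t₀), integral_sub iM (jM.const_mul t₀), integral_const_mul,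
    integral_const_mul, fK, fM] at hint
  linarith

/-! ### Unit mountains -/

theorem height_pos_of_volume_mountain (hd : 2 ≤ d) (hF : Convex ℝ F) (hFc : IsCompact F)
    (hFvol : volume F = 1) {z : Space d} (hz : 0 ≤ z.2) (hvol : volume (Mountain F z) = 1) :
    0 < z.2 := by
  refine lt_of_le_of_ne hz fun h => ?_
  rw [volume_mountain hd hF hFc hFvol hz, ← h] at hvol
  simp at hvol

theorem mountain_mem_CCSF (hF : Convex ℝ F) (hFc : IsCompact F)
    (hF0 : F.Nonempty) {z : Space d} (hz : 0 < z.2) (hvol : volume (Mountain F z) = 1) :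
    Mountain F z ∈ CCSF F := by
  rw [mountain_eq] at hvol ⊢
  exact convexHull_baseCopy_union_mem_CCSF hF (convex_singleton _) hF0 (singleton_nonempty _) hFc
    isCompact_singleton hz hvol

theorem Q_le_of_mem_unitMountains (hd : 2 ≤ d) (hFc : IsCompact F) (hF : Convex ℝ F)
    (hFvol : volume F = 1) (hsub : UnitMountains F ⊆ CCSF F) {M K : Set (Space d)}
    (hM : M ∈ UnitMountains F) (hK : K ∈ CCSF F) : Q F M ≤ Q F K := by
  have hM' := hsub hM
  obtain ⟨⟨z, hz, rfl⟩, hvol⟩ := hM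
  rw [Q_eq hd hFc hF hFvol hM', Q_eq hd hFc hF hFvol hK]
  have := integral_height_le hd hFc hF hFvol hK
    (height_pos_of_volume_mountain hd hF hFc hFvol hz hvol) hM'
  gcongr

/-! ### Trapezoids -/

theorem volume_trapezoid (hF : Convex ℝ F) (hFc : IsCompact F) (hFvol : volume F = 1) {c h : ℝ}
    (hc : 0 ≤ c) (hh : 0 < h) :
    volume (Trapezoid F c h) = ENNReal.ofReal (h * frustumFactor (d - 1) c) := by
  have hF0 : F.Nonempty := nonempty_of_measure_ne_zero (μ := volume) (by simp [hFvol])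
  have e : (fun x => c • x) '' F = c • F := rfl
  rw [Trapezoid, e, volume_convexHull_baseCopy_union hF (hF.smul c) hF0 hF0.smul_set hFc
    (hFc.smul c) hh, ← lintegral_Icc_frustum hc hh]
  refine setLIntegral_congr_fun measurableSet_Icc fun t ht => ?_
  have h1 : 0 ≤ 1 - t / h := sub_nonneg.2 ((div_le_one hh).2 ht.2)
  have h2 : 0 ≤ t / h * c := mul_nonneg (div_nonneg ht.1 hh.le) hc
  simp only [smul_smul]
  rw [← hF.add_smul h1 h2, volume_smul_eq (add_nonneg h1 h2), hFvol, mul_one]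

theorem integral_height_trapezoid_le (hF : Convex ℝ F) (hF0 : F.Nonempty) {c h : ℝ} (hh : 0 < h)
    (hT : Trapezoid F c h ∈ CCSF F) : ∫ x in Trapezoid F c h, x.2 ≤ h := by
  have hm := hT.1.measurableSet
  calc ∫ x in Trapezoid F c h, x.2 ≤ ∫ x in Trapezoid F c h, h := by
        refine setIntegral_mono_on (integrableOn_height hT.1)
          (integrableOn_const hT.1.measure_lt_top.ne) hm fun x hx => ?_
        exact ((slice_convexHull_baseCopy_union hF (hF.smul c) hF0 hF0.smul_set hh).1 hx).1.2
    _ = h := by simp [Measure.real, hT.2.2.2]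

/-- A wide roof forces a small height, hence a small mean height: `c` is chosen so that the height
`h = 1 / frustumFactor (d - 1) c` of the trapezoid of volume one is at most `α`. -/
theorem exists_trapezoid (hd : 2 ≤ d) (hFc : IsCompact F) (hF : Convex ℝ F) (hFvol : volume F = 1)
    {α : ℝ} (hα : 0 < α) : ∃ c h : ℝ, 0 < c ∧ 0 < h ∧
      Trapezoid F c h ∈ CCSF F ∧ 1 - α ≤ Q F (Trapezoid F c h) := by
  have hF0 : F.Nonempty := nonempty_of_measure_ne_zero (μ := volume) (by simp [hFvol])
  set c : ℝ := 1 + 2 / α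
  have hc : 1 ≤ c := le_add_of_nonneg_right (by positivity)
  have hJ := le_frustumFactor (n := d - 1) (by lia) hc
  set J := frustumFactor (d - 1) c
  have hJ0 : 0 < J := by linarith
  have hT : Trapezoid F c J⁻¹ ∈ CCSF F := by
    refine convexHull_baseCopy_union_mem_CCSF hF (hF.smul c) hF0 hF0.smul_set hFc (hFc.smul c)
      (inv_pos.2 hJ0) ?_
    have := volume_trapezoid hF hFc hFvol (zero_le_one.trans hc) (inv_pos.2 hJ0)
    rwa [inv_mul_cancel₀ hJ0.ne', ENNReal.ofReal_one] at this
  refine ⟨c, J⁻¹, by linarith, inv_pos.2 hJ0, hT, ?_⟩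
  rw [Q_eq hd hFc hF hFvol hT]
  have h1 := integral_height_trapezoid_le hF hF0 (inv_pos.2 hJ0) hT
  have h2 : J⁻¹ ≤ α := by
    rw [inv_le_comm₀ hJ0 hα]
    have : 2 / α = 2 * α⁻¹ := by ring
    have : α⁻¹ ≤ (1 + c) / 2 := by simp only [c]; linarith
    linarith
  have h3 : (2 : ℝ) / d ≤ 1 := div_le_one_of_le₀ (by exact_mod_cast hd) (by positivity)
  have h4 := mul_le_mul h3 (h1.trans h2) (integral_height_pos hT).le zero_le_one
  linarith

end

theorem theorem2 (d : ℕ) (hd : 2 ≤ d) (F : Set (Fin (d - 1) → ℝ))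
    (hFcompact : IsCompact F) (hFconvex : Convex ℝ F) (hFvol : MeasureTheory.volume F = 1) :
    -- unit mountains exist, are elements of `CCSF F`, and share one value of `Q`
    (UnitMountains F).Nonempty ∧ UnitMountains F ⊆ CCSF F ∧
    (∀ M ∈ UnitMountains F, ∀ M' ∈ UnitMountains F, Q F M = Q F M') ∧
    -- the two bounds
    (∀ K ∈ CCSF F, (∀ M ∈ UnitMountains F, Q F M ≤ Q F K) ∧ Q F K < 1) ∧
    -- the upper bound is approached, by trapezoids
    (∀ α : ℝ, 0 < α → ∃ c h : ℝ, 0 < c ∧ 0 < h ∧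
      Trapezoid F c h ∈ CCSF F ∧ 1 - α ≤ Q F (Trapezoid F c h)) ∧
    -- and never attained
    (¬ ∃ K ∈ CCSF F, Q F K = 1) := by
  have hF0 : F.Nonempty := nonempty_of_measure_ne_zero (μ := volume) (by simp [hFvol])
  have hsub : UnitMountains F ⊆ CCSF F := by
    rintro _ ⟨⟨z, hz, rfl⟩, hvol⟩
    exact mountain_mem_CCSF hFconvex hFcompact hF0
      (height_pos_of_volume_mountain hd hFconvex hFcompact hFvol hz hvol) hvol
  have hmin : ∀ M ∈ UnitMountains F, ∀ K ∈ CCSF F, Q F M ≤ Q F K := fun M hM K hK =>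
    Q_le_of_mem_unitMountains hd hFcompact hFconvex hFvol hsub hM hK
  have hlt : ∀ K ∈ CCSF F, Q F K < 1 := by
    intro K hK
    rw [Q_eq hd hFcompact hFconvex hFvol hK]
    have hd0 : (0 : ℝ) < d := by exact_mod_cast (by lia : 0 < d)
    have := mul_pos (div_pos two_pos hd0) (integral_height_pos hK)
    linarith
  refine ⟨⟨Mountain F (0, (d : ℝ)), ⟨_, Nat.cast_nonneg d, rfl⟩, ?_⟩, hsub, ?_, ?_, ?_, ?_⟩
  · rw [volume_mountain hd hFconvex hFcompact hFvol (Nat.cast_nonneg d)]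
    simp [show (d : ℝ) ≠ 0 by exact_mod_cast (by lia : d ≠ 0)]
  · exact fun M hM M' hM' =>
      le_antisymm (hmin M hM M' (hsub hM')) (hmin M' hM' M (hsub hM))
  · exact fun K hK => ⟨fun M hM => hmin M hM K hK, hlt K hK⟩
  · exact fun α hα => exists_trapezoid hd hFcompact hFconvex hFvol hα
  · rintro ⟨K, hK, h⟩
    exact (hlt K hK).ne h
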